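/- Let $O_n(\mathbb{C})=\{Q\in\mathbb{C}^{n\times n} : Q^TQ=I\}$ act on complex symmetric $n\times n$ matrices by orthogonal similarity, $\Phi(Q,A)=Q^{-1}AQ$, and let $\mathrm{Stab}_\Phi(A)=\{Q\in O_n(\mathbb{C}) : Q^{-1}AQ=A\}$. For $m\ge 1$ and $z\in\mathbb{C}$ let $J_m(z)$ be the $m\times m$ Jordan block (with $z$ on the diagonal and $1$ on the first superdiagonal), and let $S_m(z)$ be the symmetric $m\times m$ matrix $$S_m(z)=\tfrac12\left(R+iT\right),$$ where $R$ has $2z$ on the diagonal, $1$ on the first sub- and superdiagonal and $0$ elsewhere, and, for $1\le p,q\le m$, $T_{pq}=-1$ if $p+q=m$, $T_{pq}=1$ if $p+q=m+2$, and $T_{pq}=0$ otherwise. Theorem 1.1. Let $A$ be a complex symmetric matrix with Jordan canonical form $\mathcal{J}(A)=\bigoplus_j J_{\alpha_j}(\lambda_j)$, and let $\mathcal{S}(A)=\bigoplus_j S_{\alpha_j}(\lambda_j)$ be its symmetric normal form. Let $\rho_1,\dots,\rho_N$ be the distinct eigenvalues of $A$, and let $\mathcal{S}(A,\rho_r)$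 be the direct sum of those blocks $S_{\alpha_j}(\lambda_j)$ with $\lambda_j=\rho_r$. Then the stabilizers $\mathrm{Stab}_\Phi(\mathcal{S}(A))$ and $\mathrm{Stab}_\Phi(\mathcal{S}(A,\rho_r))$ are complex submanifolds of the respective spaces of complex square matrices, and $$\dim_{\mathbb{C}}\mathrm{Stab}_\Phi(\mathcal{S}(A))=\sum_{r=1}^N\dim_{\mathbb{C}}\mathrm{Stab}_\Phi(\mathcal{S}(A,\rho_r)).$$ Moreover, if $A$ has only one eigenvalue $\lambda$, so that up to the order of the blocks $\mathcal{S}(A)=\bigoplus_{r=1}^N\bigl(\bigoplus_{j=1}^{m_r}S_{\alpha_r}(\lambda)\bigr)$ with $\alpha_1>\alpha_2>\dots>\alpha_N$, then $$\dim_{\mathbb{C}}\mathrm{Stab}_\Phi(\mathcal{S}(A))=\sum_{r=1}^N\alpha_r m_r\Bigl(\tfrac12(m_r-1)+\sum_{s=1}^{r-1}m_s\Bigr).$$ -/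

import Mathlib

open scoped Matrix Matrix.Norms.Operator

noncomputable section

namespace OrthSim

/-- `S` is a nonempty embedded complex submanifold, of complex dimension `d` at each of its points,
of the finite-dimensional complex normed space `E`: around every point of `S` there is a
biholomorphic coordinate change of the ambient space which straightens `S` to a `d`-dimensional
complex linear subspace. -/
def HasComplexDim {E : Type*} [NormedAddCommGroup E] [NormedSpace ℂ E]
    (S : Set E) (d : ℕ) : Prop :=
  S.Nonempty ∧
  ∀ x ∈ S, ∃ (φ : OpenPartialHomeomorph E E) (F : Submodule ℂ E),
    x ∈ φ.source ∧
    DifferentiableOn ℂ φ φ.source ∧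
    DifferentiableOn ℂ φ.symm φ.target ∧
    Module.finrank ℂ F = d ∧
    ∀ y ∈ φ.source, y ∈ S ↔ φ y ∈ F

lemma HasComplexDim.le {E : Type*} [NormedAddCommGroup E] [NormedSpace ℂ E]
    [FiniteDimensional ℂ E] {S : Set E} {d₁ d₂ : ℕ}
    (h₁ : HasComplexDim S d₁) (h₂ : HasComplexDim S d₂) : d₁ ≤ d₂ := by
  obtain ⟨⟨x, hx⟩, h₁⟩ := h₁
  obtain ⟨φ, F, hφ, dφ, dφs, rfl, hF⟩ := h₁ x hx
  obtain ⟨ψ, G, hψ, dψ, dψs, rfl, hG⟩ := h₂.2 x hx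
  have hp : φ x ∈ φ.target := φ.map_source hφ
  have e : φ.symm (φ x) = x := φ.left_inv hφ
  have D1 : HasFDerivAt φ.symm (fderiv ℂ φ.symm (φ x)) (φ x) :=
    ((dφs (φ x) hp).differentiableAt (φ.open_target.mem_nhds hp)).hasFDerivAt
  have D2 : HasFDerivAt φ (fderiv ℂ φ (φ.symm (φ x))) (φ.symm (φ x)) := by
    rw [e]; exact ((dφ x hφ).differentiableAt (φ.open_source.mem_nhds hφ)).hasFDerivAt
  have D3 : HasFDerivAt ψ (fderiv ℂ ψ (φ.symm (φ x))) (φ.symm (φ x)) := by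
    rw [e]; exact ((dψ x hψ).differentiableAt (ψ.open_source.mem_nhds hψ)).hasFDerivAt
  have D4 : HasFDerivAt ψ.symm (fderiv ℂ ψ.symm (ψ x)) (ψ (φ.symm (φ x))) := by
    rw [e]
    exact ((dψs _ (ψ.map_source hψ)).differentiableAt
      (ψ.open_target.mem_nhds (ψ.map_source hψ))).hasFDerivAt
  have D := D3.comp (φ x) D1
  set T := (fderiv ℂ ψ (φ.symm (φ x))).comp (fderiv ℂ φ.symm (φ x)) with hT
  have ev : ∀ᶠ w in nhds (φ x), φ.symm w ∈ ψ.source ∧ w ∈ φ.target := by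
    refine Filter.Eventually.and ?_ (φ.open_target.mem_nhds hp)
    refine D1.continuousAt.eventually_mem (ψ.open_source.mem_nhds ?_)
    rwa [e]
  -- the derivative of the transition map is injective
  have hinj : Function.Injective T := by
    have D24 : HasFDerivAt φ (fderiv ℂ φ (φ.symm (φ x))) ((ψ.symm ∘ ψ ∘ φ.symm) (φ x)) := by
      have e' : (ψ.symm ∘ ψ ∘ φ.symm) (φ x) = φ.symm (φ x) := by
        simp only [Function.comp_apply, e, ψ.left_inv hψ]
      rwa [e']
    have D5 : HasFDerivAt (ψ.symm ∘ ψ ∘ φ.symm) ((fderiv ℂ ψ.symm (ψ x)).comp T) (φ x) :=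
      HasFDerivAt.comp (f := ψ ∘ φ.symm) (φ x) D4 D
    have C := D24.comp (φ x) D5
    have C' : HasFDerivAt (fun w : E => w) (ContinuousLinearMap.id ℂ E) (φ x) := hasFDerivAt_id _
    have C2 := C'.congr_of_eventuallyEq (f₁ := φ ∘ ψ.symm ∘ ψ ∘ φ.symm) (by
      filter_upwards [ev] with w hw
      simp [ψ.left_inv hw.1, φ.right_inv hw.2])
    have C3 := C.unique C2
    intro v w hvw
    have hv := congrArg (fun L : E →L[ℂ] E => L v) C3
    have hw := congrArg (fun L : E →L[ℂ] E => L w) C3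
    simp only [ContinuousLinearMap.comp_apply, ContinuousLinearMap.id_apply] at hv hw
    rw [← hv, ← hw]
    exact congrArg _ (congrArg _ hvw)
  have hmap : ∀ v ∈ F, T v ∈ G := by
    intro v hv
    have hl : HasDerivAt (fun t : ℂ => φ x + t • v) v 0 := by
      simpa using ((hasDerivAt_id (0 : ℂ)).smul_const v).const_add (φ x)
    have D' : HasFDerivAt (ψ ∘ φ.symm) T (φ x + (0 : ℂ) • v) := by simpa using D
    have hg := D'.comp_hasDerivAt (0 : ℂ) hl
    have hc : Filter.Tendsto (fun t : ℂ => φ x + t • v) (nhds 0) (nhds (φ x)) := by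
      simpa using hl.continuousAt.tendsto
    have hxF : φ x ∈ F := (hF x hφ).1 hx
    have evG : ∀ᶠ t : ℂ in nhds 0, (ψ ∘ φ.symm) (φ x + t • v) ∈ G := by
      filter_upwards [hc.eventually ev] with t ht
      refine (hG _ ht.1).1 ((hF _ (φ.map_target ht.2)).2 ?_)
      rw [φ.right_inv ht.2]
      exact F.add_mem hxF (F.smul_mem t hv)
    have hlim := hasDerivAt_iff_tendsto_slope.1 hg
    refine (Submodule.closed_of_finiteDimensional G).mem_of_tendsto hlim ?_
    filter_upwards [nhdsWithin_le_nhds evG] with t ht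
    rw [slope_def_module]
    exact G.smul_mem _ (G.sub_mem ht evG.self_of_nhds)
  exact LinearMap.finrank_le_finrank_of_injective
    (f := (T : E →ₗ[ℂ] E).restrict hmap)
    (fun a b hab => Subtype.ext (hinj (congrArg Subtype.val hab)))

/-- The complex dimension of a complex submanifold is well defined. -/
theorem HasComplexDim.unique {E : Type*} [NormedAddCommGroup E] [NormedSpace ℂ E]
    [FiniteDimensional ℂ E] {S : Set E} {d₁ d₂ : ℕ}
    (h₁ : HasComplexDim S d₁) (h₂ : HasComplexDim S d₂) : d₁ = d₂ :=
  le_antisymm (h₁.le h₂) (h₂.le h₁)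

/-- Complex symmetric matrices with index set `n`. -/
abbrev SymMatrix (n : Type*) : Type _ := {A : Matrix n n ℂ // A.IsSymm}

variable {n : Type*} [Fintype n] [DecidableEq n]

/-- The action `Φ(Q, A) = Q⁻¹ A Q` of orthogonal similarity on complex symmetric matrices. -/
def orthSimilarity (Q : Matrix.orthogonalGroup n ℂ) (A : SymMatrix n) : SymMatrix n :=
  ⟨(Q : Matrix n n ℂ)⁻¹ * (A : Matrix n n ℂ) * (Q : Matrix n n ℂ), by
    have h := (Matrix.mem_orthogonalGroup_iff' n ℂ).1 Q.2
    rw [Matrix.inv_eq_left_inv h, Matrix.IsSymm, Matrix.transpose_mul, Matrix.transpose_mul,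
      Matrix.transpose_transpose, A.2.eq, Matrix.mul_assoc]⟩

/-- The stabilizer of `A` for the action of orthogonal similarity, seen inside the space of all
matrices. -/
def stabilizer (A : SymMatrix n) : Set (Matrix n n ℂ) :=
  {X | ∃ Q : Matrix.orthogonalGroup n ℂ, (Q : Matrix n n ℂ) = X ∧ orthSimilarity Q A = A}

/-- The elementary `m × m` Jordan block with eigenvalue `z`. -/
def jordanBlock (m : ℕ) (z : ℂ) : Matrix (Fin m) (Fin m) ℂ :=
  Matrix.of fun i j => if i = j then z else if (i : ℕ) + 1 = j then 1 else 0

/-- The symmetric `m × m` block `S_m(z)`. In the real part, `2z` is on the diagonal and `1` on the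
two neighbouring diagonals; in the imaginary part, `1` stands just below the antidiagonal and `-1`
just above it. -/
def symBlock (m : ℕ) (z : ℂ) : Matrix (Fin m) (Fin m) ℂ :=
  Matrix.of fun i j => (1 / 2 : ℂ) *
    ((if i = j then 2 * z else if (i : ℕ) + 1 = j ∨ (j : ℕ) + 1 = i then 1 else 0) +
      Complex.I * (if (i : ℕ) + j = m then 1 else if (i : ℕ) + j + 2 = m then -1 else 0))

lemma symBlock_isSymm (m : ℕ) (z : ℂ) : (symBlock m z).IsSymm := by
  ext i j
  simp only [symBlock, Matrix.transpose_apply, Matrix.of_apply, eq_comm (a := j) (b := i),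
    or_comm (a := (j : ℕ) + 1 = i), add_comm (j : ℕ) (i : ℕ)]

/-- `⨁ⱼ J_{αⱼ}(λⱼ)` is a Jordan canonical form of `A`. -/
def IsJordanForm (A : Matrix n n ℂ) {ι : Type*} [Fintype ι] [DecidableEq ι]
    (α : ι → ℕ) (lam : ι → ℂ) : Prop :=
  (∀ j, 0 < α j) ∧
  ∃ (e : (Σ j, Fin (α j)) ≃ n) (P : (Matrix n n ℂ)ˣ),
    A = (P : Matrix n n ℂ) *
      Matrix.reindex e e (Matrix.blockDiagonal' fun j => jordanBlock (α j) (lam j)) *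
      ((P⁻¹ : (Matrix n n ℂ)ˣ) : Matrix n n ℂ)

/-- The symmetric normal form `⨁ⱼ S_{αⱼ}(λⱼ)` belonging to `⨁ⱼ J_{αⱼ}(λⱼ)`. -/
def symNormalForm {ι : Type*} [DecidableEq ι] (α : ι → ℕ) (lam : ι → ℂ) :
    SymMatrix (Σ j, Fin (α j)) :=
  ⟨Matrix.blockDiagonal' fun j => symBlock (α j) (lam j), by
    rw [Matrix.IsSymm, Matrix.blockDiagonal'_transpose]
    exact congrArg _ (funext fun j => (symBlock_isSymm (α j) (lam j)).eq)⟩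

/-- The direct sum of those blocks of `⨁ⱼ S_{αⱼ}(λⱼ)` that have the eigenvalue `ρ`. -/
def eigenPart {ι : Type*} [DecidableEq ι] (α : ι → ℕ) (lam : ι → ℂ) (ρ : ℂ) :
    SymMatrix (Σ j : {j // lam j = ρ}, Fin (α j)) :=
  symNormalForm (fun j : {j // lam j = ρ} => α j) (fun j => lam j)

end OrthSim

end

/-! The stabilizer consists of the orthogonal matrices commuting with the symmetric normal form `S`.
The Cayley transform exchanges orthogonal and skew-symmetric matrices and respects commutation with
`S`. Composed with left translations, it provides charts straightening the stabilizer to its Lie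
algebra `skewCommutant` (`hasComplexDim_stabilizer`), so only a linear dimension remains to be
found.

A symmetric invertible `P` satisfies `S P = P J` with `J` the Jordan matrix, and `X ↦ P X P` turns
the Lie algebra into the skew `Y` with `Y J = Jᵀ Y`. Blocks of `Y` between different eigenvalues
vanish. The others are Hankel, with `min (α i) (α j)` free coefficients. Diagonal blocks are then
both symmetric and skew, hence zero, and skewness ties block `(j, i)` to block `(i, j)`. The
dimension is therefore the sum of `min (α i) (α j)` over pairs `i < j` with equal eigenvalue
(`finrank_skewHankel`). Additivity over eigenvalues and the closed formula are rearrangements of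
this sum. -/

namespace OrthSim

/-! ### The Cayley transform -/

section Cayley

variable {R : Type*} [NormedRing R] [NormedAlgebra ℂ R]

/-- The Cayley transform `X ↦ 2 (1 + X)⁻¹ - 1`. -/
noncomputable def cayleyFun (X : R) : R := (2 : ℂ) • Ring.inverse (1 + X) - 1

lemma inverse_two_smul (u : Rˣ) :
    Ring.inverse ((2 : ℂ) • (u : R)) = (1 / 2 : ℂ) • ((u⁻¹ : Rˣ) : R) := by
  have h : (2 : ℂ) • (u : R) * ((1 / 2 : ℂ) • ((u⁻¹ : Rˣ) : R)) = 1 := by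
    rw [smul_mul_smul_comm, Units.mul_inv]; norm_num
  have h' : ((1 / 2 : ℂ) • ((u⁻¹ : Rˣ) : R)) * (2 : ℂ) • (u : R) = 1 := by
    rw [smul_mul_smul_comm, Units.inv_mul]; norm_num
  exact Ring.inverse_unit ⟨_, _, h, h'⟩

lemma one_add_cayleyFun (X : R) : 1 + cayleyFun X = (2 : ℂ) • Ring.inverse (1 + X) := by
  simp [cayleyFun]

lemma isUnit_one_add_cayleyFun {X : R} (h : IsUnit (1 + X)) : IsUnit (1 + cayleyFun X) := by
  rw [one_add_cayleyFun]
  obtain ⟨u, hu⟩ := h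
  rw [← hu, Ring.inverse_unit]
  exact (u⁻¹.isUnit).smul (Units.mk0 (2 : ℂ) two_ne_zero)

/-- In the variable `u = 1 + X` the transform is `u ↦ 2 u⁻¹`, visibly an involution. -/
lemma cayleyFun_cayleyFun {X : R} (h : IsUnit (1 + X)) : cayleyFun (cayleyFun X) = X := by
  rw [cayleyFun, one_add_cayleyFun]
  obtain ⟨u, hu⟩ := h
  rw [← hu, Ring.inverse_unit, inverse_two_smul, inv_inv, smul_smul, hu]
  norm_num

variable [CompleteSpace R]

lemma differentiableOn_cayleyFun : DifferentiableOn ℂ (cayleyFun (R := R)) {X | IsUnit (1 + X)} := by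
  intro X hX
  have h : DifferentiableAt ℂ (fun Y : R => Ring.inverse (1 + Y)) X := by
    obtain ⟨u, hu⟩ : IsUnit (1 + X) := hX
    refine DifferentiableAt.comp (g := Ring.inverse) X ?_ (by fun_prop)
    rw [← hu]
    exact differentiableAt_inverse u.isUnit
  exact ((h.const_smul (2 : ℂ)).sub_const 1).differentiableWithinAt

/-- The Cayley transform as a partial homeomorphism. -/
noncomputable def cayley : OpenPartialHomeomorph R R where
  toFun := cayleyFun
  invFun := cayleyFun
  source := {X | IsUnit (1 + X)}
  target := {X | IsUnit (1 + X)}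
  map_source' _ h := isUnit_one_add_cayleyFun h
  map_target' _ h := isUnit_one_add_cayleyFun h
  left_inv' _ h := cayleyFun_cayleyFun h
  right_inv' _ h := cayleyFun_cayleyFun h
  open_source := Units.isOpen.preimage (continuous_const.add continuous_id)
  open_target := Units.isOpen.preimage (continuous_const.add continuous_id)
  continuousOn_toFun := differentiableOn_cayleyFun.continuousOn
  continuousOn_invFun := differentiableOn_cayleyFun.continuousOn

end Cayley

/-! ### Stabilizers as complex submanifolds -/

variable {n : Type*} [Fintype n] [DecidableEq n]

/-- The skew-symmetric matrices that commute with `A`. -/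
def skewCommutant (A : Matrix n n ℂ) : Submodule ℂ (Matrix n n ℂ) where
  carrier := {X | Xᵀ = -X ∧ X * A = A * X}
  add_mem' {X Y} hX hY := by
    refine ⟨?_, ?_⟩
    · rw [Matrix.transpose_add, hX.1, hY.1, neg_add]
    · rw [add_mul, mul_add, hX.2, hY.2]
  zero_mem' := by simp
  smul_mem' c X hX := by
    refine ⟨?_, ?_⟩
    · rw [Matrix.transpose_smul, hX.1, smul_neg]
    · rw [smul_mul_assoc, mul_smul_comm, hX.2]

lemma mem_skewCommutant {A X : Matrix n n ℂ} :
    X ∈ skewCommutant A ↔ Xᵀ = -X ∧ X * A = A * X := Iff.rfl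

lemma mem_stabilizer {A : SymMatrix n} {X : Matrix n n ℂ} :
    X ∈ stabilizer A ↔ Xᵀ * X = 1 ∧ X * (A : Matrix n n ℂ) = A * X := by
  have key (Q : Matrix n n ℂ) (h : Qᵀ * Q = 1) :
      Q⁻¹ * (A : Matrix n n ℂ) * Q = A ↔ Q * (A : Matrix n n ℂ) = A * Q := by
    have h' : Q * Qᵀ = 1 := mul_eq_one_comm.1 h
    rw [Matrix.inv_eq_left_inv h]
    constructor
    · intro H
      rw [← H, ← mul_assoc, ← mul_assoc, h', one_mul, H]
    · intro H
      rw [mul_assoc, ← H, ← mul_assoc, h, one_mul]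
  constructor
  · rintro ⟨Q, rfl, h⟩
    have hQ := (Matrix.mem_orthogonalGroup_iff' n ℂ).1 Q.2
    exact ⟨hQ, (key _ hQ).1 (congrArg Subtype.val h)⟩
  · rintro ⟨h, h'⟩
    exact ⟨⟨X, (Matrix.mem_orthogonalGroup_iff' n ℂ).2 h⟩, rfl, Subtype.ext ((key X h).2 h')⟩

/-- With `u = 1 + X` and `V = u⁻¹`, skewness of `2V - 1` means `Vᵀ + V = 1`. Multiplying by `uᵀ` on
the left and `u` on the right gives `u + uᵀ = uᵀ u`, which is orthogonality of `u - 1`. Commuting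
with `A` is insensitive to inverses, nonzero scalars and shifts by `1`. -/
lemma cayleyFun_mem_skewCommutant_iff {A : SymMatrix n} {X : Matrix n n ℂ} (h : IsUnit (1 + X)) :
    cayleyFun X ∈ skewCommutant (A : Matrix n n ℂ) ↔ X ∈ stabilizer A := by
  obtain ⟨u, hu⟩ := h
  have hX : X = u - 1 := by rw [hu]; abel
  set V : Matrix n n ℂ := ((u⁻¹ : (Matrix n n ℂ)ˣ) : Matrix n n ℂ) with hV
  have hUV : (u : Matrix n n ℂ) * V = 1 := u.mul_inv
  have hVU : V * (u : Matrix n n ℂ) = 1 := u.inv_mul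
  have hVUt : (u : Matrix n n ℂ)ᵀ * Vᵀ = 1 := by rw [← Matrix.transpose_mul, hVU, Matrix.transpose_one]
  have hUVt : Vᵀ * (u : Matrix n n ℂ)ᵀ = 1 := by rw [← Matrix.transpose_mul, hUV, Matrix.transpose_one]
  rw [mem_stabilizer, mem_skewCommutant, cayleyFun, ← hu, Ring.inverse_unit, ← hV]
  have h2 : (2 : ℂ) • V = V + V := two_smul _ _
  refine and_congr ?_ ?_
  · have e1 : ((2 : ℂ) • V - 1)ᵀ = -((2 : ℂ) • V - 1) ↔ Vᵀ + V = 1 := by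
      rw [Matrix.transpose_sub, Matrix.transpose_smul, Matrix.transpose_one, neg_sub]
      constructor
      · intro H
        have : (2 : ℂ) • (Vᵀ + V) = (2 : ℂ) • (1 : Matrix n n ℂ) := by
          rw [smul_add, two_smul ℂ (1 : Matrix n n ℂ), ← sub_eq_zero]
          rw [← sub_eq_zero] at H
          rw [← H]; abel
        exact smul_right_injective _ (two_ne_zero (α := ℂ)) this
      · intro H
        rw [eq_sub_of_add_eq H, smul_sub, two_smul ℂ (1 : Matrix n n ℂ)]; abel
    rw [e1, hX, Matrix.transpose_sub, Matrix.transpose_one]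
    have e2 : ((u : Matrix n n ℂ)ᵀ - 1) * (u - 1) =
        (u : Matrix n n ℂ)ᵀ * u - ((u : Matrix n n ℂ)ᵀ + u) + 1 := by noncomm_ring
    rw [e2, add_eq_right, sub_eq_zero]
    constructor
    · intro H
      calc (u : Matrix n n ℂ)ᵀ * u = (u : Matrix n n ℂ)ᵀ * (Vᵀ + V) * u := by rw [H, mul_one]
        _ = u + (u : Matrix n n ℂ)ᵀ := by rw [mul_add, add_mul, hVUt, one_mul, mul_assoc, hVU, mul_one]
        _ = _ := add_comm _ _
    · intro H
      calc Vᵀ + V = Vᵀ * ((u : Matrix n n ℂ)ᵀ + u) * V := by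
            rw [mul_add, add_mul, hUVt, one_mul, mul_assoc, hUV, mul_one, add_comm]
        _ = 1 := by rw [← H, mul_assoc, mul_assoc, hUV, mul_one, hUVt]
  · have e1 (c : ℂ) (hc : c ≠ 0) (W B : Matrix n n ℂ) :
        (c • W - 1) * B = B * (c • W - 1) ↔ W * B = B * W := by
      rw [sub_mul, mul_sub, one_mul, mul_one, sub_left_inj, smul_mul_assoc, mul_smul_comm]
      exact (smul_right_injective _ hc).eq_iff
    have e2 := e1 1 one_ne_zero u A
    rw [one_smul] at e2
    rw [e1 2 two_ne_zero, hX, e2]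
    exact ⟨fun H => (show Commute (u : Matrix n n ℂ) A from (Commute.units_inv_left_iff.1 H)),
      fun H => Commute.units_inv_left_iff.2 H⟩

/-- The stabilizer of `A` is a complex submanifold, of the dimension of its Lie algebra. -/
theorem hasComplexDim_stabilizer (A : SymMatrix n) :
    HasComplexDim (stabilizer A) (Module.finrank ℂ (skewCommutant (A : Matrix n n ℂ))) := by
  refine ⟨⟨1, mem_stabilizer.2 (by simp)⟩, fun Q hQ => ?_⟩
  obtain ⟨hQ1, hQA⟩ := mem_stabilizer.1 hQ
  have hQ2 : Q * Qᵀ = 1 := mul_eq_one_comm.1 hQ1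
  have hQA' : Qᵀ * (A : Matrix n n ℂ) = A * Qᵀ := by
    rw [← mul_one (Qᵀ * (A : Matrix n n ℂ)), ← hQ2, ← mul_assoc, mul_assoc Qᵀ, ← hQA, ← mul_assoc,
      hQ1, one_mul]
  -- Translation by `Qᵀ` preserves the stabilizer and moves `Q` to `1`, which lies in the Cayley
  -- domain because `1 + 1` is invertible.
  let h : Matrix n n ℂ ≃ₜ Matrix n n ℂ :=
    { toFun := fun X => Qᵀ * X
      invFun := fun X => Q * X
      left_inv := fun X => by simp only [← mul_assoc, hQ2, one_mul]
      right_inv := fun X => by simp only [← mul_assoc, hQ1, one_mul]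
      continuous_toFun := continuous_const.mul continuous_id
      continuous_invFun := continuous_const.mul continuous_id }
  refine ⟨h.transOpenPartialHomeomorph cayley, skewCommutant (A : Matrix n n ℂ), ?_, ?_, ?_, rfl, ?_⟩
  · change IsUnit (1 + Qᵀ * Q)
    rw [hQ1, ← two_smul ℂ]
    exact isUnit_one.smul (Units.mk0 (2 : ℂ) two_ne_zero)
  · exact differentiableOn_cayleyFun.comp (f := fun X => Qᵀ * X) (differentiableOn_id.const_mul Qᵀ)
      fun X hX => hX
  · exact differentiableOn_cayleyFun.const_mul Q
  · intro Y hY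
    change Y ∈ stabilizer A ↔ cayleyFun (Qᵀ * Y) ∈ skewCommutant (A : Matrix n n ℂ)
    have hY' : IsUnit (1 + Qᵀ * Y) := hY
    rw [cayleyFun_mem_skewCommutant_iff hY', mem_stabilizer, mem_stabilizer]
    refine and_congr ?_ ?_
    · rw [Matrix.transpose_mul, Matrix.transpose_transpose, mul_assoc, ← mul_assoc Q, hQ2, one_mul]
    · rw [mul_assoc, ← mul_assoc (A : Matrix n n ℂ), ← hQA', mul_assoc Qᵀ]
      refine ⟨fun H => by rw [H], fun H => ?_⟩
      have := congrArg (Q * ·) H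
      simpa only [← mul_assoc, hQ2, one_mul] using this

/-! ### From Jordan blocks to symmetric blocks -/

/-- The permutation matrix with `1` on the antidiagonal. -/
def antidiagonal (m : ℕ) : Matrix (Fin m) (Fin m) ℂ :=
  (1 : Matrix (Fin m) (Fin m) ℂ).submatrix id Fin.rev

lemma mul_antidiagonal {m : ℕ} (M : Matrix (Fin m) (Fin m) ℂ) :
    M * antidiagonal m = M.submatrix id Fin.rev := by
  ext i j
  simp [antidiagonal, Matrix.mul_apply, Matrix.one_apply]

lemma antidiagonal_mul {m : ℕ} (M : Matrix (Fin m) (Fin m) ℂ) :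
    antidiagonal m * M = M.submatrix Fin.rev id := by
  ext i j
  simp only [antidiagonal, Matrix.mul_apply, Matrix.one_apply, Matrix.submatrix_apply, id,
    ite_mul, one_mul, zero_mul, ← Fin.rev_eq_iff (i := i)]
  simp

lemma antidiagonal_mul_self (m : ℕ) : antidiagonal m * antidiagonal m = 1 := by
  rw [mul_antidiagonal]
  ext i j
  rw [antidiagonal, Matrix.submatrix_apply, Matrix.submatrix_apply, Fin.rev_rev, id, id]

lemma antidiagonal_transpose (m : ℕ) : (antidiagonal m)ᵀ = antidiagonal m := by
  ext i j
  simp only [antidiagonal, Matrix.transpose_apply, Matrix.submatrix_apply, id, Matrix.one_apply]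
  simp only [← Fin.rev_eq_iff (i := i), eq_comm]

lemma antidiagonal_mul_jordanBlock (m : ℕ) (z : ℂ) :
    antidiagonal m * jordanBlock m z = (jordanBlock m z)ᵀ * antidiagonal m := by
  rw [antidiagonal_mul, mul_antidiagonal]
  ext i j
  simp only [jordanBlock, Matrix.submatrix_apply, Matrix.transpose_apply, Matrix.of_apply, id,
    Fin.ext_iff, Fin.val_rev]
  have := i.2
  have := j.2
  congr 1
  · apply propext; omega
  · congr 1
    apply propext; omega

lemma symBlock_eq (m : ℕ) (z : ℂ) :
    symBlock m z = (1 / 2 : ℂ) • (jordanBlock m z + (jordanBlock m z)ᵀ +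
      Complex.I • (antidiagonal m * jordanBlock m z - jordanBlock m z * antidiagonal m)) := by
  rw [antidiagonal_mul, mul_antidiagonal]
  ext i j
  simp only [symBlock, jordanBlock, Matrix.submatrix_apply, Matrix.transpose_apply,
    Matrix.of_apply, id, Matrix.smul_apply, Matrix.add_apply, Matrix.sub_apply, smul_eq_mul]
  congr 2
  · simp only [Fin.ext_iff]
    split_ifs <;> first | (exfalso; omega) | ring
  · congr 1
    have := i.2
    have := j.2
    simp only [Fin.ext_iff, Fin.val_rev]
    split_ifs <;> first | (exfalso; omega) | ring

/-- A symmetric matrix that carries the Jordan block to the symmetric block. -/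
def transition (m : ℕ) : Matrix (Fin m) (Fin m) ℂ := 1 + Complex.I • antidiagonal m

lemma transition_transpose (m : ℕ) : (transition m)ᵀ = transition m := by
  simp [transition, antidiagonal_transpose]

lemma transition_mul (m : ℕ) :
    transition m * ((1 / 2 : ℂ) • (1 - Complex.I • antidiagonal m)) = 1 := by
  have h : transition m * (1 - Complex.I • antidiagonal m) = (2 : ℂ) • 1 := by
    rw [transition, add_mul, one_mul, mul_sub, mul_one, smul_mul_smul_comm, antidiagonal_mul_self,
      Complex.I_mul_I, two_smul, neg_one_smul]
    abel
  rw [mul_smul_comm, h, smul_smul]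
  norm_num

/-- Only `F² = 1` and `F J F = Jᵀ` are needed for the flip `F`, so both matrices are generalized and
the identity is checked in a noncommutative algebra. -/
lemma symBlock_mul_transition (m : ℕ) (z : ℂ) :
    symBlock m z * transition m = transition m * jordanBlock m z := by
  have h1 := antidiagonal_mul_jordanBlock m z
  have h2 := antidiagonal_mul_self m
  rw [symBlock_eq, transition]
  generalize antidiagonal m = F at *
  generalize jordanBlock m z = J at *
  have h3 : F * J * F = Jᵀ := by rw [h1, mul_assoc, h2, mul_one]
  have h4 : J * F * F = J := by rw [mul_assoc, h2, mul_one]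
  have e : (J + Jᵀ + Complex.I • (F * J - J * F)) * (1 + Complex.I • F) =
      (2 : ℂ) • ((1 + Complex.I • F) * J) := by
    simp only [mul_add, add_mul, mul_one, one_mul, mul_smul_comm, smul_mul_assoc, sub_mul, h3, h4,
      ← h1, smul_smul, Complex.I_mul_I, smul_sub, smul_add, two_mul, add_smul, two_smul, neg_one_smul]
    abel
  rw [smul_mul_assoc, e, smul_smul]
  norm_num

/-! ### The Lie algebra as skew block Hankel matrices -/

section Dimension

variable {ι : Type*} [Fintype ι] [DecidableEq ι] (α : ι → ℕ) (lam : ι → ℂ)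

/-- The Jordan matrix `⨁ⱼ J_{αⱼ}(λⱼ)`. -/
abbrev jordanMatrix : Matrix (Σ j, Fin (α j)) (Σ j, Fin (α j)) ℂ :=
  Matrix.blockDiagonal' fun j => jordanBlock (α j) (lam j)

/-- The skew-symmetric matrices `Y` with `Y J = Jᵀ Y`, where `J` is a Jordan matrix. -/
def skewHankel : Submodule ℂ (Matrix (Σ j, Fin (α j)) (Σ j, Fin (α j)) ℂ) where
  carrier := {Y | Yᵀ = -Y ∧ Y * jordanMatrix α lam = (jordanMatrix α lam)ᵀ * Y}
  add_mem' {X Y} hX hY := by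
    refine ⟨?_, ?_⟩
    · rw [Matrix.transpose_add, hX.1, hY.1, neg_add]
    · rw [add_mul, mul_add, hX.2, hY.2]
  zero_mem' := by simp
  smul_mem' c X hX := by
    refine ⟨?_, ?_⟩
    · rw [Matrix.transpose_smul, hX.1, smul_neg]
    · rw [smul_mul_assoc, mul_smul_comm, hX.2]

/-- Transposing `S P = P J` gives `P S = Jᵀ P`, since `S` and `P` are symmetric. The congruence `X ↦
P X P` keeps skewness and turns `X S = S X` into `Y J = Jᵀ Y`. -/
lemma finrank_skewCommutant_eq_skewHankel :
    Module.finrank ℂ (skewCommutant (symNormalForm α lam).1) =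
      Module.finrank ℂ (skewHankel α lam) := by
  set S : Matrix (Σ j, Fin (α j)) (Σ j, Fin (α j)) ℂ := (symNormalForm α lam).1 with hS
  have hSt : Sᵀ = S := (symNormalForm α lam).2
  set J := jordanMatrix α lam with hJ
  set P : Matrix (Σ j, Fin (α j)) (Σ j, Fin (α j)) ℂ :=
    Matrix.blockDiagonal' fun j => transition (α j) with hP
  obtain ⟨W, hW⟩ : ∃ W, P * W = 1 := by
    refine ⟨Matrix.blockDiagonal' fun j =>
      (1 / 2 : ℂ) • (1 - Complex.I • antidiagonal (α j)), ?_⟩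
    rw [hP, ← Matrix.blockDiagonal'_mul]
    simp only [transition_mul]
    exact Matrix.blockDiagonal'_one
  have hW' : W * P = 1 := mul_eq_one_comm.1 hW
  have hPt : Pᵀ = P := by
    rw [hP, Matrix.blockDiagonal'_transpose]
    simp only [transition_transpose]
  have hWt : Wᵀ = W := by
    have h : Wᵀ * P = 1 := by rw [← hPt, ← Matrix.transpose_mul, hW, Matrix.transpose_one]
    calc Wᵀ = Wᵀ * (P * W) := by rw [hW, mul_one]
      _ = W := by rw [← mul_assoc, h, one_mul]
  have hSP : S * P = P * J := by
    rw [hS, hP, hJ, symNormalForm, ← Matrix.blockDiagonal'_mul, ← Matrix.blockDiagonal'_mul]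
    simp only [symBlock_mul_transition]
  have hPS : P * S = Jᵀ * P := by
    have := congrArg Matrix.transpose hSP
    rwa [Matrix.transpose_mul, Matrix.transpose_mul, hSt, hPt] at this
  have hS' : W * Jᵀ = S * W := by
    calc W * Jᵀ = W * (Jᵀ * P) * W := by rw [mul_assoc, mul_assoc, hW, mul_one]
      _ = S * W := by rw [← hPS, ← mul_assoc, hW', one_mul]
  have hS'' : J * W = W * S := by
    calc J * W = W * (P * J) * W := by rw [← mul_assoc, hW', one_mul]
      _ = W * S := by rw [← hSP, mul_assoc, mul_assoc, hW, mul_one]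
  refine LinearEquiv.finrank_eq
    { toFun := fun X => ⟨P * X * P, ?_, ?_⟩
      invFun := fun Y => ⟨W * Y * W, ?_, ?_⟩
      map_add' := fun X Y => Subtype.ext (by simp [mul_add, add_mul])
      map_smul' := fun c X => Subtype.ext (by simp)
      left_inv := fun X => Subtype.ext ?_
      right_inv := fun Y => Subtype.ext ?_ }
  · rw [Matrix.transpose_mul, Matrix.transpose_mul, hPt, X.2.1, neg_mul, mul_neg,
      mul_assoc]
  · rw [mul_assoc, ← hSP, ← mul_assoc, mul_assoc P, X.2.2, ← mul_assoc, hPS, mul_assoc, mul_assoc,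
      mul_assoc]
  · rw [Matrix.transpose_mul, Matrix.transpose_mul, hWt, Y.2.1, neg_mul, mul_neg, mul_assoc]
  · rw [mul_assoc, ← hS'', ← mul_assoc, mul_assoc W, Y.2.2, ← mul_assoc, hS', mul_assoc, mul_assoc,
      mul_assoc]
  · change W * (P * X * P) * W = X
    rw [mul_assoc, mul_assoc, hW, mul_one, ← mul_assoc, hW', one_mul]
  · change P * (W * Y * W) * P = Y
    rw [mul_assoc, mul_assoc, hW', mul_one, ← mul_assoc, hW, one_mul]

variable {α lam}

lemma mul_jordanBlock_apply {m : Type*} {b : ℕ} (B : Matrix m (Fin b) ℂ) (z : ℂ) (p : m)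
    (q : Fin b) :
    (B * jordanBlock b z) p q =
      z * B p q + if (q : ℕ) = 0 then 0 else B p ⟨q - 1, by omega⟩ := by
  have h (s : Fin b) : B p s * jordanBlock b z s q =
      (if s = q then z * B p s else 0) + if (s : ℕ) + 1 = q then B p s else 0 := by
    simp only [jordanBlock, Matrix.of_apply, Fin.ext_iff]
    split_ifs <;> first | (exfalso; omega) | ring
  rw [Matrix.mul_apply, Finset.sum_congr rfl fun s _ => h s, Finset.sum_add_distrib]
  congr 1
  · simp
  · split_ifs with h0
    · exact Finset.sum_eq_zero fun s _ => if_neg (by omega)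
    · rw [Finset.sum_eq_single ⟨q - 1, by omega⟩]
      · exact if_pos (by simp only; omega)
      · intro s _ hs
        exact if_neg fun H => hs (Fin.ext (by simp only; omega))
      · simp

lemma mul_jordanMatrix_apply {m : Type*} (Y : Matrix m (Σ j, Fin (α j)) ℂ) (x : m) (j : ι)
    (q : Fin (α j)) :
    (Y * jordanMatrix α lam) x ⟨j, q⟩ =
      lam j * Y x ⟨j, q⟩ + if (q : ℕ) = 0 then 0 else Y x ⟨j, ⟨q - 1, by omega⟩⟩ := by
  refine Eq.trans ?_ (mul_jordanBlock_apply (Matrix.of fun x s => Y x ⟨j, s⟩) (lam j) x q)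
  rw [Matrix.mul_apply, Matrix.mul_apply, Fintype.sum_sigma, Finset.sum_eq_single j]
  · simp [Matrix.blockDiagonal'_apply_eq]
  · intro l _ hl
    refine Finset.sum_eq_zero fun s _ => ?_
    rw [jordanMatrix, Matrix.blockDiagonal'_apply_ne _ _ _ hl, mul_zero]
  · simp

lemma jordanMatrix_transpose_mul_apply {m : Type*} (Y : Matrix (Σ j, Fin (α j)) m ℂ) (x : m)
    (i : ι) (p : Fin (α i)) :
    ((jordanMatrix α lam)ᵀ * Y) ⟨i, p⟩ x =
      lam i * Y ⟨i, p⟩ x + if (p : ℕ) = 0 then 0 else Y ⟨i, ⟨p - 1, by omega⟩⟩ x := by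
  have h := mul_jordanMatrix_apply (lam := lam) Yᵀ x i p
  rw [← Matrix.transpose_transpose Y, ← Matrix.transpose_mul]
  exact h

lemma mem_skewHankel {Y : Matrix (Σ j, Fin (α j)) (Σ j, Fin (α j)) ℂ} :
    Y ∈ skewHankel α lam ↔ Yᵀ = -Y ∧ ∀ i j (p : Fin (α i)) (q : Fin (α j)),
      (lam j * Y ⟨i, p⟩ ⟨j, q⟩ + if (q : ℕ) = 0 then 0 else Y ⟨i, p⟩ ⟨j, ⟨q - 1, by omega⟩⟩) =
      lam i * Y ⟨i, p⟩ ⟨j, q⟩ + if (p : ℕ) = 0 then 0 else Y ⟨i, ⟨p - 1, by omega⟩⟩ ⟨j, q⟩ := by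
  refine and_congr Iff.rfl ?_
  simp only [← mul_jordanMatrix_apply, ← jordanMatrix_transpose_mul_apply]
  exact ⟨fun h i j p q => by rw [h], fun h => Matrix.ext fun x y => h x.1 y.1 x.2 y.2⟩

/-- The relation expresses `(lam j - lam i)` times an entry through entries with smaller `p + q`, so
induction on `p + q` applies. -/
lemma skewHankel_apply_eq_zero_of_ne {Y : Matrix (Σ j, Fin (α j)) (Σ j, Fin (α j)) ℂ}
    (hY : Y ∈ skewHankel α lam) {i j : ι} (h : lam i ≠ lam j) (p : Fin (α i)) (q : Fin (α j)) :
    Y ⟨i, p⟩ ⟨j, q⟩ = 0 := by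
  obtain ⟨-, hY⟩ := mem_skewHankel.1 hY
  have key : ∀ s : ℕ, ∀ (p : Fin (α i)) (q : Fin (α j)), (p : ℕ) + q = s → Y ⟨i, p⟩ ⟨j, q⟩ = 0 := by
    intro s
    induction s using Nat.strong_induction_on with
    | _ s ih =>
      intro p q hs
      have e := hY i j p q
      have e1 : (if (q : ℕ) = 0 then 0 else Y ⟨i, p⟩ ⟨j, ⟨q - 1, by omega⟩⟩) = 0 := by
        split_ifs
        · rfl
        · exact ih (s - 1) (by omega) _ _ (by simp only; omega)
      have e2 : (if (p : ℕ) = 0 then 0 else Y ⟨i, ⟨p - 1, by omega⟩⟩ ⟨j, q⟩) = 0 := by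
        split_ifs
        · rfl
        · exact ih (s - 1) (by omega) _ _ (by simp only; omega)
      rw [e1, e2, add_zero, add_zero, ← sub_eq_zero, ← sub_mul] at e
      exact (mul_eq_zero.1 e).resolve_left (sub_ne_zero.2 h.symm)
  exact key _ p q rfl

section SameEigenvalue

variable {Y : Matrix (Σ j, Fin (α j)) (Σ j, Fin (α j)) ℂ} (hY : Y ∈ skewHankel α lam) {i j : ι}
  (h : lam i = lam j)

include hY h

lemma skewHankel_shift (p : ℕ) (q : ℕ) (hp : p + 1 < α i) (hq : q + 1 < α j) :
    Y ⟨i, ⟨p, by omega⟩⟩ ⟨j, ⟨q + 1, hq⟩⟩ = Y ⟨i, ⟨p + 1, hp⟩⟩ ⟨j, ⟨q, by omega⟩⟩ := by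
  have e := (mem_skewHankel.1 hY).2 i j ⟨p + 1, hp⟩ ⟨q + 1, hq⟩
  rw [h] at e
  simpa using e.symm

lemma skewHankel_apply_zero_right (p : ℕ) (hp : p + 1 < α i) (hq : 0 < α j) :
    Y ⟨i, ⟨p, by omega⟩⟩ ⟨j, ⟨0, hq⟩⟩ = 0 := by
  have e := (mem_skewHankel.1 hY).2 i j ⟨p + 1, hp⟩ ⟨0, hq⟩
  rw [h] at e
  simpa using e.symm

lemma skewHankel_apply_zero_left (q : ℕ) (hq : q + 1 < α j) (hp : 0 < α i) :
    Y ⟨i, ⟨0, hp⟩⟩ ⟨j, ⟨q, by omega⟩⟩ = 0 := by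
  have e := (mem_skewHankel.1 hY).2 i j ⟨0, hp⟩ ⟨q + 1, hq⟩
  rw [h] at e
  simpa using e

/-- Sliding along the antidiagonal to row `0` lands before the last column, where the boundary
relation forces zero. -/
lemma skewHankel_apply_eq_zero (p q : ℕ) (hp : p < α i) (hpq : p + q + 1 < α j) :
    Y ⟨i, ⟨p, hp⟩⟩ ⟨j, ⟨q, by omega⟩⟩ = 0 := by
  induction p generalizing q with
  | zero => exact skewHankel_apply_zero_left hY h q (by omega) hp
  | succ p ih =>
    rw [← skewHankel_shift hY h p q hp (by omega)]
    exact ih (q + 1) (by omega) (by omega)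

/-- Each of `d` slides goes one row down and one column left; reaching column `0` above the last row
gives zero. -/
lemma skewHankel_apply_eq_last (d p q : ℕ) (hp : p + d + 1 = α i) (hq : q < α j) :
    Y ⟨i, ⟨p, by omega⟩⟩ ⟨j, ⟨q, hq⟩⟩ =
      if d ≤ q then Y ⟨i, ⟨α i - 1, by omega⟩⟩ ⟨j, ⟨q - d, by omega⟩⟩ else 0 := by
  induction d generalizing p q with
  | zero =>
    obtain rfl : p = α i - 1 := by omega
    simp
  | succ d ih =>
    cases q with
    | zero => simpa using skewHankel_apply_zero_right hY h p (by omega) hq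
    | succ q =>
      rw [skewHankel_shift hY h p q (by omega) hq, ih (p + 1) q (by omega) (by omega)]
      simp

lemma skewHankel_apply_eq_zero_of_last
    (H : ∀ k, (hi : k < α i) → (hj : k < α j) →
      Y ⟨i, ⟨α i - 1, by omega⟩⟩ ⟨j, ⟨α j - 1 - k, by omega⟩⟩ = 0)
    (p : Fin (α i)) (q : Fin (α j)) : Y ⟨i, p⟩ ⟨j, q⟩ = 0 := by
  obtain ⟨p, hp⟩ := p
  obtain ⟨q, hq⟩ := q
  rw [skewHankel_apply_eq_last hY h (α i - 1 - p) p q (by omega) hq]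
  split_ifs with hd
  -- `H` covers the last `min (α i) (α j)` entries of the last row; any entry further left has `p +
  -- q + 1 < α j`.
  · by_cases hk : α j - 1 - (q - (α i - 1 - p)) < α i
    · rw [← H _ hk (by omega)]
      congr 3
      omega
    · exact skewHankel_apply_eq_zero hY h _ _ _ (by omega)
  · rfl

omit h in
lemma skewHankel_apply_diag (p q : Fin (α i)) : Y ⟨i, p⟩ ⟨i, q⟩ = 0 := by
  obtain ⟨p, hp⟩ := p
  obtain ⟨q, hq⟩ := q
  -- A Hankel square is symmetric: a slide lowers the column-row difference by two, hence the base
  -- cases `0` and `1`.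
  have hsym : ∀ d p q, (hp : p < α i) → (hq : q < α i) → p + d = q →
      Y ⟨i, ⟨p, hp⟩⟩ ⟨i, ⟨q, hq⟩⟩ = Y ⟨i, ⟨q, hq⟩⟩ ⟨i, ⟨p, hp⟩⟩ := by
    intro d
    induction d using Nat.strong_induction_on with
    | _ d ih =>
      intro p q hp hq hd
      rcases d with _ | _ | d
      · obtain rfl : p = q := by omega
        rfl
      · obtain rfl : p + 1 = q := by omega
        exact skewHankel_shift hY rfl p p hq hq
      · obtain ⟨q, rfl⟩ : ∃ q', q = q' + 1 := ⟨q - 1, by omega⟩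
        rw [skewHankel_shift hY rfl p q (by omega) hq, ih d (by omega) (p + 1) q _ _ (by omega),
          skewHankel_shift hY rfl q p hq (by omega)]
  have hskew (x y) : Y y x = -Y x y := congrFun (congrFun hY.1 x) y
  have h1 : Y ⟨i, ⟨p, hp⟩⟩ ⟨i, ⟨q, hq⟩⟩ = Y ⟨i, ⟨q, hq⟩⟩ ⟨i, ⟨p, hp⟩⟩ := by
    rcases le_total p q with hpq | hpq
    · exact hsym (q - p) p q hp hq (by omega)
    · exact (hsym (p - q) q p hq hp (by omega)).symm
  have h2 := hskew ⟨i, ⟨q, hq⟩⟩ ⟨i, ⟨p, hp⟩⟩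
  rw [← h1] at h2
  exact self_eq_neg.1 h2

end SameEigenvalue

end Dimension

/-! ### Counting the free parameters -/

section

variable {ι : Type*} [LinearOrder ι] (α : ι → ℕ) (lam : ι → ℂ)

/-- The pairs of distinct blocks with a common eigenvalue. -/
abbrev LinkedPair : Type _ := {t : ι × ι // t.1 < t.2 ∧ lam t.1 = lam t.2}

/-- The free parameters of a matrix in `skewHankel α lam`. -/
abbrev HankelIndex : Type _ := Σ t : LinkedPair lam, Fin (min (α t.1.1) (α t.1.2))

variable {α lam}

/-- The antisymmetric family of Hankel coefficients with given parameters. -/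
noncomputable def hankelCoeff (c : HankelIndex α lam → ℂ) (i j : ι) (k : ℕ) : ℂ :=
  if h : (i < j ∧ lam i = lam j) ∧ k < min (α i) (α j) then
    c ⟨⟨(i, j), h.1⟩, ⟨k, h.2⟩⟩
  else if h : (j < i ∧ lam j = lam i) ∧ k < min (α j) (α i) then
    -c ⟨⟨(j, i), h.1⟩, ⟨k, h.2⟩⟩
  else 0

lemma hankelCoeff_swap (c : HankelIndex α lam → ℂ) (i j : ι) (k : ℕ) :
    hankelCoeff c j i k = -hankelCoeff c i j k := by
  unfold hankelCoeff
  by_cases h1 : (i < j ∧ lam i = lam j) ∧ k < min (α i) (α j)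
  · rw [dif_pos h1, dif_neg fun h => lt_asymm h1.1.1 h.1.1, dif_pos h1]
  · rw [dif_neg h1, dif_neg h1]
    split_ifs <;> simp

lemma hankelCoeff_of_ne (c : HankelIndex α lam → ℂ) {i j : ι} (h : lam i ≠ lam j) (k : ℕ) :
    hankelCoeff c i j k = 0 := by
  rw [hankelCoeff, dif_neg fun H => h H.1.2, dif_neg fun H => h H.1.2.symm]

lemma hankelCoeff_of_le (c : HankelIndex α lam → ℂ) {i j : ι} {k : ℕ} (h : min (α i) (α j) ≤ k) :
    hankelCoeff c i j k = 0 := by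
  rw [hankelCoeff, dif_neg fun H => H.2.not_ge h,
    dif_neg fun H => H.2.not_ge ((min_comm _ _).trans_le h)]

/-- The block Hankel matrix with given parameters. -/
noncomputable def hankelMatrix (c : HankelIndex α lam → ℂ) : Matrix (Σ j, Fin (α j)) (Σ j, Fin (α j)) ℂ :=
  Matrix.of fun x y => hankelCoeff c x.1 y.1 (α x.1 + α y.1 - 2 - (x.2 + y.2))

variable [Fintype ι]

variable (α lam) in
/-- The last rows of the blocks above the diagonal. -/
def lastRows : skewHankel α lam →ₗ[ℂ] (HankelIndex α lam → ℂ) where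
  toFun Y x := Y.1 ⟨x.1.1.1, ⟨α x.1.1.1 - 1, by have := x.2.2; omega⟩⟩
    ⟨x.1.1.2, ⟨α x.1.1.2 - 1 - x.2, by have := x.2.2; omega⟩⟩
  map_add' _ _ := rfl
  map_smul' _ _ := rfl

variable (α lam) in
lemma lastRows_injective : Function.Injective (lastRows α lam) := by
  rw [← LinearMap.ker_eq_bot, LinearMap.ker_eq_bot']
  intro Y hY
  have hlt (i j : ι) (hij : i < j) (p : Fin (α i)) (q : Fin (α j)) : Y.1 ⟨i, p⟩ ⟨j, q⟩ = 0 := by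
    by_cases h : lam i = lam j
    · refine skewHankel_apply_eq_zero_of_last Y.2 h (fun k hi hj => ?_) p q
      exact congrFun hY ⟨⟨(i, j), hij, h⟩, ⟨k, lt_min hi hj⟩⟩
    · exact skewHankel_apply_eq_zero_of_ne Y.2 h p q
  refine Subtype.ext (Matrix.ext fun x y => ?_)
  obtain ⟨i, p⟩ := x
  obtain ⟨j, q⟩ := y
  change Y.1 ⟨i, p⟩ ⟨j, q⟩ = 0
  rcases lt_trichotomy i j with hij | rfl | hij
  · exact hlt i j hij p q
  · exact skewHankel_apply_diag Y.2 p q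
  · have hskew : Y.1 ⟨i, p⟩ ⟨j, q⟩ = -Y.1 ⟨j, q⟩ ⟨i, p⟩ :=
      congrFun (congrFun Y.2.1 ⟨j, q⟩) ⟨i, p⟩
    rw [hskew, hlt j i hij, neg_zero]

lemma hankelMatrix_mem (c : HankelIndex α lam → ℂ) : hankelMatrix c ∈ skewHankel α lam := by
  refine mem_skewHankel.2 ⟨?_, fun i j p q => ?_⟩
  · ext x y
    simp only [hankelMatrix, Matrix.transpose_apply, Matrix.neg_apply, Matrix.of_apply]
    rw [hankelCoeff_swap, add_comm (α y.1), add_comm (y.2 : ℕ)]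
  · simp only [hankelMatrix, Matrix.of_apply]
    by_cases h : lam i = lam j
    · rw [h]
      congr 1
      have := p.2
      have := q.2
      split_ifs with hq hp hp
      · rfl
      -- The coefficient index is the antidiagonal distance to the lower right corner; here it is at
      -- least `α j`.
      · exact (hankelCoeff_of_le c (by omega)).symm
      · exact hankelCoeff_of_le c (by omega)
      · congr 1
        omega
    · simp only [hankelCoeff_of_ne c h]
      simp

lemma lastRows_surjective : Function.Surjective (lastRows α lam) := by
  intro c
  refine ⟨⟨hankelMatrix c, hankelMatrix_mem c⟩, funext fun x => ?_⟩
  obtain ⟨⟨⟨i, j⟩, hij⟩, k, hk⟩ := x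
  change hankelCoeff c i j (α i + α j - 2 - (α i - 1 + (α j - 1 - k))) = _
  have hk' : k < min (α i) (α j) := hk
  have e : α i + α j - 2 - (α i - 1 + (α j - 1 - k)) = k := by omega
  rw [e, hankelCoeff, dif_pos ⟨hij, hk⟩]

variable (α lam)

lemma finrank_skewHankel :
    Module.finrank ℂ (skewHankel α lam) =
      ∑ i, ∑ j, if i < j ∧ lam i = lam j then min (α i) (α j) else 0 := by
  classical
  rw [(LinearEquiv.ofBijective (lastRows α lam)
    ⟨lastRows_injective α lam, lastRows_surjective⟩).finrank_eq,
    Module.finrank_fintype_fun_eq_card, Fintype.card_sigma]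
  simp only [Fintype.card_fin]
  rw [← Fintype.sum_prod_type' (f := fun i j => if i < j ∧ lam i = lam j then min (α i) (α j) else 0),
    ← Finset.sum_filter]
  exact (Finset.sum_subtype _ (by simp) fun t : ι × ι => min (α t.1) (α t.2)).symm

lemma hasComplexDim_symNormalForm :
    HasComplexDim (stabilizer (symNormalForm α lam))
      (∑ i, ∑ j, if i < j ∧ lam i = lam j then min (α i) (α j) else 0) := by
  rw [← finrank_skewHankel, ← finrank_skewCommutant_eq_skewHankel]
  exact hasComplexDim_stabilizer _

end

/-! ### Eigenvalues of the Jordan form -/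

section Spectrum

variable {n : Type*} [Fintype n] [DecidableEq n] {ι : Type*} [Fintype ι] [DecidableEq ι]

lemma IsJordanForm.mem_spectrum {A : Matrix n n ℂ} {α : ι → ℕ} {lam : ι → ℂ}
    (h : IsJordanForm A α lam) (j : ι) : lam j ∈ spectrum ℂ A := by
  obtain ⟨hα, e, P, rfl⟩ := h
  rw [spectrum.units_conjugate]
  change lam j ∈ spectrum ℂ (Matrix.reindexAlgEquiv ℂ ℂ e (jordanMatrix α lam))
  rw [AlgEquiv.spectrum_eq, spectrum.mem_iff, Matrix.isUnit_iff_isUnit_det, isUnit_iff_ne_zero,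
    not_not]
  -- The last row of block `j` has no superdiagonal entry, so it vanishes in `lam j - J`; positivity
  -- of `α j` makes this row exist.
  refine Matrix.det_eq_zero_of_row_eq_zero ⟨j, ⟨α j - 1, Nat.sub_lt (hα j) one_pos⟩⟩ fun y => ?_
  obtain ⟨l, q⟩ := y
  rw [Matrix.sub_apply, Matrix.algebraMap_matrix_apply]
  by_cases hl : j = l
  · subst hl
    rw [jordanMatrix, Matrix.blockDiagonal'_apply_eq, jordanBlock, Matrix.of_apply]
    have := q.2
    simp only [Sigma.mk.injEq, heq_eq_eq, true_and, Fin.ext_iff, Algebra.algebraMap_self,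
      RingHom.id_apply]
    split_ifs <;> first | (exfalso; omega) | simp
  · rw [jordanMatrix, Matrix.blockDiagonal'_apply_ne _ _ _ hl,
      if_neg fun h => hl (congrArg Sigma.fst h), sub_zero]

end Spectrum

/-! ### Rearranging the dimension sum -/

lemma two_mul_sum_lt_add_sum_diag {ι : Type*} [Fintype ι] [LinearOrder ι] (f : ι → ι → ℝ)
    (hf : ∀ i j, f i j = f j i) :
    2 * (∑ i, ∑ j, if i < j then f i j else 0) + ∑ i, f i i = ∑ i, ∑ j, f i j := by
  have h : (∑ i, ∑ j, if i < j then f i j else 0) = ∑ i, ∑ j, if j < i then f i j else 0 := by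
    rw [Finset.sum_comm]
    simp only [hf]
  have h' : ∑ i, f i i = ∑ i, ∑ j, if i = j then f i j else 0 := by simp
  rw [two_mul]
  nth_rewrite 2 [h]
  rw [h', ← Finset.sum_add_distrib, ← Finset.sum_add_distrib]
  refine Finset.sum_congr rfl fun i _ => ?_
  rw [← Finset.sum_add_distrib, ← Finset.sum_add_distrib]
  refine Finset.sum_congr rfl fun j _ => ?_
  rcases lt_trichotomy i j with hij | rfl | hij
  · simp [hij, hij.not_gt, hij.ne]
  · simp
  · simp [hij, hij.not_gt, hij.ne']

lemma sum_sum_fiber {ι κ : Type*} [Fintype ι] [Fintype κ] (g : ι → ℂ) (ρ : κ → ℂ)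
    (hρ : Function.Injective ρ) (h : ∀ j, g j ∈ Set.range ρ) (f : ι → ι → ℕ)
    (hf : ∀ i j, g i ≠ g j → f i j = 0) :
    ∑ r, ∑ i : {j // g j = ρ r}, ∑ j : {j // g j = ρ r}, f i j = ∑ i, ∑ j, f i j := by
  classical
  choose c hc using h
  have hmem (r : κ) (j : ι) : j ∈ Finset.univ.filter (fun j => c j = r) ↔ g j = ρ r := by
    rw [Finset.mem_filter_univ, ← hc, hρ.eq_iff]
  rw [← Finset.sum_fiberwise Finset.univ c]
  refine Finset.sum_congr rfl fun r _ => ?_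
  rw [Finset.sum_subtype _ (hmem r)]
  refine Finset.sum_congr rfl fun i _ => ?_
  rw [← Finset.sum_subtype _ (hmem r) (fun j => f i j)]
  refine Finset.sum_subset (Finset.subset_univ _) fun j _ hj => hf _ _ fun hij => hj ?_
  rw [hmem, ← hij, i.2]

/-- The bijection `e` need not respect the order of the blocks. Passing to the full symmetric double
sum removes the order; after grouping by size, the sum is folded back over `r < s`, where the
minimum is known. -/
lemma sum_lt_min_eq {ι : Type*} [Fintype ι] [LinearOrder ι] (α : ι → ℕ) {N : ℕ} (a m : Fin N → ℕ)
    (e : (Σ r, Fin (m r)) ≃ ι) (ha : StrictAnti a) (hα : ∀ x, α (e x) = a x.1) :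
    ((∑ i, ∑ j, if i < j then min (α i) (α j) else 0 : ℕ) : ℝ) =
      ∑ r, (a r : ℝ) * m r * (((m r : ℝ) - 1) / 2 + ∑ s ∈ Finset.Iio r, (m s : ℝ)) := by
  have h1 := two_mul_sum_lt_add_sum_diag (fun i j => ((min (α i) (α j) : ℕ) : ℝ))
    fun i j => by rw [min_comm]
  have h2 := two_mul_sum_lt_add_sum_diag (fun r s => (m r : ℝ) * m s * ((min (a r) (a s) : ℕ) : ℝ))
    fun i j => by rw [min_comm, mul_comm (m i : ℝ)]
  have e1 : ∑ i, ∑ j, ((min (α i) (α j) : ℕ) : ℝ) =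
      ∑ r, ∑ s, (m r : ℝ) * m s * ((min (a r) (a s) : ℕ) : ℝ) := by
    simp only [← e.sum_comp, hα, Fintype.sum_sigma, Finset.sum_const, Finset.card_univ,
      Fintype.card_fin, nsmul_eq_mul, Finset.mul_sum, mul_assoc]
  have e2 : ∑ i, ((min (α i) (α i) : ℕ) : ℝ) = ∑ r, (m r : ℝ) * a r := by
    simp only [← e.sum_comp, hα, Fintype.sum_sigma, Finset.sum_const, Finset.card_univ,
      Fintype.card_fin, nsmul_eq_mul, min_self]
  have e3 : (∑ r, ∑ s, if r < s then (m r : ℝ) * m s * ((min (a r) (a s) : ℕ) : ℝ) else 0) =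
      ∑ r, (a r : ℝ) * m r * ∑ s ∈ Finset.Iio r, (m s : ℝ) := by
    -- The larger index becomes the outer one, since it carries the smaller size and so the minimum.
    rw [Finset.sum_comm]
    refine Finset.sum_congr rfl fun s _ => ?_
    rw [← Finset.sum_filter, Finset.mul_sum]
    refine Finset.sum_congr (by ext; simp) fun r hr => ?_
    rw [min_eq_right (ha (Finset.mem_Iio.1 hr)).le]
    ring
  have e4 : (∑ r, (a r : ℝ) * m r * (((m r : ℝ) - 1) / 2 + ∑ s ∈ Finset.Iio r, (m s : ℝ))) =
      ((∑ r, (m r : ℝ) * m r * ((min (a r) (a r) : ℕ) : ℝ)) - ∑ r, (m r : ℝ) * a r) / 2 +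
      ∑ r, (a r : ℝ) * m r * ∑ s ∈ Finset.Iio r, (m s : ℝ) := by
    rw [← Finset.sum_sub_distrib, Finset.sum_div, ← Finset.sum_add_distrib]
    refine Finset.sum_congr rfl fun r _ => ?_
    rw [min_self]
    ring
  have e0 : ((∑ i, ∑ j, if i < j then min (α i) (α j) else 0 : ℕ) : ℝ) =
      ∑ i, ∑ j, if i < j then ((min (α i) (α j) : ℕ) : ℝ) else 0 := by
    rw [Nat.cast_sum]
    refine Finset.sum_congr rfl fun i _ => ?_
    rw [Nat.cast_sum]
    exact Finset.sum_congr rfl fun j _ => by rw [Nat.cast_ite, Nat.cast_zero]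
  rw [e0, e4, ← e3]
  linarith

end OrthSim

theorem theorem1p1 {n : ℕ} (A : Matrix (Fin n) (Fin n) ℂ) (hA : A.IsSymm)
    {k : ℕ} (α : Fin k → ℕ) (lam : Fin k → ℂ) (hJ : OrthSim.IsJordanForm A α lam) :
    (∀ {N : ℕ} (ρ : Fin N → ℂ), Function.Injective ρ → Set.range ρ = spectrum ℂ A →
      ∃ d : Fin N → ℕ,
        (∀ r, OrthSim.HasComplexDim
          (OrthSim.stabilizer (OrthSim.eigenPart α lam (ρ r))) (d r)) ∧
        OrthSim.HasComplexDim (OrthSim.stabilizer (OrthSim.symNormalForm α lam)) (∑ r, d r)) ∧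
    (∀ {N : ℕ} (a m : Fin N → ℕ) (z : ℂ) (e : (Σ r, Fin (m r)) ≃ Fin k),
      StrictAnti a → (∀ x, α (e x) = a x.1) → (∀ j, lam j = z) →
      ∃ d : ℕ,
        OrthSim.HasComplexDim (OrthSim.stabilizer (OrthSim.symNormalForm α lam)) d ∧
        (d : ℝ) = ∑ r, (a r : ℝ) * m r *
          (((m r : ℝ) - 1) / 2 + ∑ s ∈ Finset.Iio r, (m s : ℝ))) := by
  refine ⟨fun {N} ρ hρ hspec => ?_, fun {N} a m z e ha hα hlam => ?_⟩
  · refine ⟨fun r => ∑ i : {j // lam j = ρ r}, ∑ j : {j // lam j = ρ r},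
      if (i : Fin k) < j ∧ lam i = lam j then min (α i) (α j) else 0, fun r => ?_, ?_⟩
    · convert OrthSim.hasComplexDim_symNormalForm
        (fun j : {j // lam j = ρ r} => α j) (fun j => lam j)
      · rw [OrthSim.eigenPart]
        congr!
      · exact Iff.rfl
    · refine Eq.mpr (congrArg _ ?_) (OrthSim.hasComplexDim_symNormalForm α lam)
      -- Every `lam j` is in the spectrum, hence a value of `ρ`, so the fibers over `ρ` exhaust the
      -- blocks.
      exact OrthSim.sum_sum_fiber lam ρ hρ (fun j => hspec ▸ hJ.mem_spectrum j)
        (fun i j => if i < j ∧ lam i = lam j then min (α i) (α j) else 0)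
        fun i j h => if_neg fun H => h H.2
  · refine ⟨_, OrthSim.hasComplexDim_symNormalForm α lam, ?_⟩
    simp only [hlam, and_true]
    exact OrthSim.sum_lt_min_eq α a m e ha hα
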